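/- Let $\mathbf{1Met}$ be the category of 1-bounded metric spaces (sets $X$ with a metric $d:X\times X\to[0,1]$) and non-expansive maps. Write $X+\mathbf 1=X\cup\{\star\}$, with the metric extending $d$ by $d(x,\star)=1$ for $x\in X$, and let $\mathcal D(Y)$ be the set of finitely supported probability distributions on $Y$. For a set $X$ let $\mathcal C^{\downarrow}(X)$ be the set of all non-empty convex sets $S\subseteq\mathcal D(X+\mathbf 1)$ that are the convex hull of a finite set and are $\bot$-closed, i.e. if $\varphi\in S$, $\psi\in\mathcal D(X+\mathbf 1)$ and $\psi(x)\le\varphi(x)$ for all $x\in X$, then $\psi\in S$. For $(X,d)\in\mathbf{1Met}$ let $K(d)$ be the Kantorovich distance on $\mathcal D(X+\mathbf 1)$, $$K(d)(\varphi,\psi)=\inf_{\omega}\sum_{(y,z)}\omega(y,z)\,d(y,z),$$ the infimum being over all couplings $\omega\in\mathcal D((X+\mathbf 1)\times(X+\mathbf 1))$ of $\varphi$ and $\psi$, and let $HK(d)$ be the Hausdorff distance on $\mathcal C^{\downarrow}(X)$ induced by $K(d)$, $$HK(d)(S,T)=\max\Big\{\sup_{\varphi\in S}\inf_{\psi\in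 T}K(d)(\varphi,\psi),\ \sup_{\psi\in T}\inf_{\varphi\in S}K(d)(\varphi,\psi)\Big\}.$$ **Theorem.** The Hausdorff–Kantorovich lifting of the $\mathbf{Set}$ monad $\mathcal C^{\downarrow}$ is a monad on $\mathbf{1Met}$. That is, $HK(d)$ is a 1-bounded metric on $\mathcal C^{\downarrow}(X)$ for every $(X,d)\in\mathbf{1Met}$, and there is a monad on $\mathbf{1Met}$ with object map $(X,d)\mapsto(\mathcal C^{\downarrow}(X),HK(d))$ whose action on morphisms, unit and multiplication are, as functions, those of the $\mathbf{Set}$ monad $\mathcal C^{\downarrow}$ (in particular these functions are well defined and non-expansive): 1. a non-expansive $f:X\to Y$ is sent to $S\mapsto\{\mathcal D(f+\mathbf 1)(\varphi)\mid\varphi\in S\}$, where $f+\mathbf 1$ extends $f$ by $\star\mapsto\star$ and $\mathcal D(f+\mathbf 1)$ is the push-forward of distributions; 2. the unit is $\eta_X(x)=\{p\,x+(1-p)\,\star\mid p\in[0,1]\}$; 3. the multiplication is $\mu_X(S)=\bigcup_{\Phi\in S}\mathtt{WMS}(\Phi^{\star})$ for $S\in\mathcal C^{\downarrow}(\mathcal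 C^{\downarrow}(X))$. Here $\Phi^{\star}$ is the push-forward of $\Phi\in\mathcal D(\mathcal C^{\downarrow}(X)+\mathbf 1)$ along the map that fixes $\mathcal C^{\downarrow}(X)$ and sends the extra point to $\{\delta_\star\}$, and for a distribution $\sum_{i=1}^n p_iU_i$ with distinct $U_i$ and $p_i>0$, $\mathtt{WMS}(\sum_i p_iU_i)=\{\sum_i p_i\varphi_i\mid\varphi_i\in U_i\}$. -/

import Mathlib

open CategoryTheory Convexity

universe u

noncomputable section

/-! ### The category of 1-bounded metric spaces and non-expansive maps -/

/-- A real-valued function `d` on `A × A` is a 1-bounded metric. -/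
structure IsOneBoundedMetric {A : Type u} (d : A → A → ℝ) : Prop where
  nonneg : ∀ a b, 0 ≤ d a b
  le_one : ∀ a b, d a b ≤ 1
  eq_zero_iff : ∀ a b, d a b = 0 ↔ a = b
  symm : ∀ a b, d a b = d b a
  triangle : ∀ a b c, d a b ≤ d a c + d c b

/-- A 1-bounded metric space. -/
structure OneMet : Type (u + 1) where
  carrier : Type u
  [metric : MetricSpace carrier]
  dist_le_one : ∀ x y : carrier, dist x y ≤ 1

attribute [instance] OneMet.metric

namespace OneMet

/-- The 1-bounded metric space given by a set and a 1-bounded metric on it. -/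
def ofDist (A : Type u) (d : A → A → ℝ) (h : IsOneBoundedMetric d) : OneMet.{u} :=
  letI : MetricSpace A :=
    { dist := d
      dist_self := fun a => (h.eq_zero_iff a a).2 rfl
      dist_comm := h.symm
      dist_triangle := fun a b c => h.triangle a c b
      eq_of_dist_eq_zero := fun {a b} hab => (h.eq_zero_iff a b).1 hab }
  { carrier := A
    dist_le_one := h.le_one }

/-- A non-expansive map between 1-bounded metric spaces. -/
@[ext]
structure Hom (X Y : OneMet.{u}) : Type u where
  toFun : X.carrier → Y.carrier
  nonexpansive : ∀ x y, dist (toFun x) (toFun y) ≤ dist x y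

instance : Category OneMet.{u} where
  Hom := Hom
  id _ := ⟨fun x => x, fun _ _ => le_rfl⟩
  comp f g := ⟨fun x => g.toFun (f.toFun x),
    fun x y => (g.nonexpansive _ _).trans (f.nonexpansive x y)⟩

end OneMet

/-! ### Finitely supported distributions and the Kantorovich and Hausdorff liftings -/

/-- `Distr A` is the set of finitely supported probability distributions on `A`.
A subdistribution on `A` is an element of `Distr (Option A)`,
where `none` is the extra point `⋆` of `A + 1`. -/
abbrev Distr (A : Type u) : Type u := StdSimplex ℝ A

/-- The metric of the coproduct of `A` with the one-point space: the distance from a point of `A`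
to the extra point is `1`. -/
def optionDist {A : Type u} (d : A → A → ℝ) : Option A → Option A → ℝ
  | some a, some b => d a b
  | none, none => 0
  | some _, none => 1
  | none, some _ => 1

/-- The couplings of two distributions. -/
def Coup {A : Type u} (φ ψ : Distr A) : Set (Distr (A × A)) :=
  {ω | ω.map Prod.fst = φ ∧ ω.map Prod.snd = ψ}

/-- The Kantorovich lifting of `d`: the infimum of the transport costs over all couplings. -/
def kantorovich {A : Type u} (d : A → A → ℝ) (φ ψ : Distr A) : ℝ :=
  ⨅ ω : Coup φ ψ, ω.1.weights.sum fun p r => r * d p.1 p.2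

/-- The Hausdorff lifting of `d`. It is used on non-empty sets and for bounded `d` only. -/
def hausdorff {A : Type u} (d : A → A → ℝ) (S T : Set A) : ℝ :=
  max (⨆ s : S, ⨅ t : T, d s t) (⨆ t : T, ⨅ s : S, d s t)

/-! ### The set functor of finitely generated `⊥`-closed convex sets of subdistributions -/

/-- Non-empty, finitely generated convex sets of distributions. -/
structure IsFGConvex {A : Type u} (S : Set (Distr A)) : Prop where
  nonempty : S.Nonempty
  convex : IsConvexSet ℝ S
  finGen : ∃ B : Set (Distr A), B.Finite ∧ S = Convexity.convexHull ℝ B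

/-- A set of subdistributions is `⊥`-closed if it contains with `φ` every subdistribution that is
pointwise below `φ` on `A`. -/
def IsBotClosed {A : Type u} (S : Set (Distr (Option A))) : Prop :=
  ∀ φ ∈ S, ∀ ψ : Distr (Option A),
    (∀ a : A, ψ.weights (some a) ≤ φ.weights (some a)) → ψ ∈ S

/-- `Cdown A` is the set of non-empty finitely generated `⊥`-closed convex sets of subdistributions
on `A`. -/
def Cdown (A : Type u) : Type u :=
  {S : Set (Distr (Option A)) // IsFGConvex S ∧ IsBotClosed S}

/-- The set of subdistributions underlying an element of `Cdown A`. -/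
def Cdown.toSet {A : Type u} (S : Cdown A) : Set (Distr (Option A)) := S.1

/-- The action of the functor on a map: the set of the push-forwards along `f + 1`. -/
def cdownMap {A B : Type u} (f : A → B) (S : Set (Distr (Option A))) : Set (Distr (Option B)) :=
  (fun φ => φ.map (Option.map f)) '' S

/-- The unit: the set of the distributions `p x + (1 - p) ⋆` with `p` in `[0, 1]`. -/
def cdownUnit {A : Type u} (x : A) : Set (Distr (Option A)) :=
  {φ | ∃ (p : ℝ) (h₀ : 0 ≤ p) (h₁ : p ≤ 1),
    φ = StdSimplex.duple (some x) none h₀ (sub_nonneg.2 h₁) (add_sub_cancel p 1)}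

/-- The weighted Minkowski sum of a distribution on sets of distributions: all the sums
`∑ U, Ψ U • g U` with `g U ∈ U` for every `U` in the support of `Ψ`. -/
def wms {A : Type u} (Ψ : Distr (Set (Distr A))) : Set (Distr A) :=
  {θ | ∃ g : Set (Distr A) → Distr A,
    (∀ U ∈ Ψ.weights.support, g U ∈ U) ∧ θ = StdSimplex.iConvexComb Ψ g}

/-- The map `C↓(A) + 1 → C(A + 1)` that is the inclusion on `C↓(A)` and sends the extra point to
`{δ_⋆}`. -/
def cdownStar {A : Type u} : Option (Cdown A) → Set (Distr (Option A))
  | some U => U.toSet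
  | none => {StdSimplex.single none}

/-- The multiplication: the union of the weighted Minkowski sums of the distributions `Φ^⋆`,
for `Φ ∈ S`, where `Φ^⋆` is the push-forward of `Φ` along `cdownStar`. -/
def cdownMul {A : Type u} (S : Set (Distr (Option (Cdown A)))) : Set (Distr (Option A)) :=
  ⋃ Φ ∈ S, wms (Φ.map cdownStar)

/-! ### The lifting to 1-bounded metric spaces -/

/-- The Hausdorff–Kantorovich distance on `C↓(X)` for a 1-bounded metric space `X`. -/
def hausKant (X : OneMet.{u}) (S T : Cdown X.carrier) : ℝ :=
  hausdorff (kantorovich (optionDist (fun x y : X.carrier => dist x y))) S.toSet T.toSet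

/-- The object `(C↓(X), HK(d))`, given that the Hausdorff–Kantorovich distance is a 1-bounded
metric on `C↓(X)` for every `X`. -/
def hkObj (h : ∀ X : OneMet.{u}, IsOneBoundedMetric (hausKant X)) (X : OneMet.{u}) : OneMet.{u} :=
  OneMet.ofDist (Cdown X.carrier) (hausKant X) (h X)

end

/-! Everything is expressed through `iConvexComb`, the Kleisli extension of the distribution monad,
whose associativity drives the algebra.

Metric: the Kantorovich distance satisfies the triangle inequality by gluing couplings
(`exists_gluing`), and the Hausdorff distance inherits it. Separation holds because the convex hull
of a finite set is closed under Kantorovich limits (`mem_convexHull_of_kantorovich_lt`).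

Monad: since the sets are convex, several choices from one set can be averaged into one. Hence the
elements of `μ S` are the combinations of some `Φ ∈ S` along a selection from the sets `cdownStar o`
(`mem_cdownMul`), and the selection may even depend on extra indices (`iConvexComb_mem_cdownMul`).
Associativity of `μ` is then associativity of combinations. The unit laws need `⊥`-closedness: a
selection from the sets `η a` only moves mass to `⋆`.

Non-expansiveness of `μ`: move along a nearly optimal coupling, choose for each pair of sets a
nearly closest partner, and use joint convexity of the Kantorovich distance
(`kantorovich_iConvexComb_le`). -/

namespace Convexity.StdSimplex

/-! ### Convex combinations, push-forwards and conditional distributions. -/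

variable {I J : Type*}

lemma weights_iConvexComb_apply (w : StdSimplex ℝ I) (f : I → StdSimplex ℝ J) (j : J) :
    (w.iConvexComb f).weights j = w.iConvexComb fun i => (f i).weights j := by
  simp [iConvexComb, Finsupp.sum_mapDomain_index, add_smul, add_mul]

lemma iConvexComb_mono {w : StdSimplex ℝ I} {f g : I → ℝ}
    (h : ∀ i, w.weights i ≠ 0 → f i ≤ g i) : w.iConvexComb f ≤ w.iConvexComb g := by
  simp only [iConvexComb_eq_sum, smul_eq_mul, Finsupp.sum]
  exact Finset.sum_le_sum fun i hi =>
    mul_le_mul_of_nonneg_left (h i (by simpa using hi)) (by simp)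

lemma iConvexComb_nonneg (w : StdSimplex ℝ I) {f : I → ℝ} (h : ∀ i, 0 ≤ f i) :
    0 ≤ w.iConvexComb f := by
  simpa using iConvexComb_mono (w := w) (f := fun _ => 0) (g := f) fun i _ => h i

lemma iConvexComb_add (w : StdSimplex ℝ I) (f g : I → ℝ) :
    (w.iConvexComb fun i => f i + g i) = w.iConvexComb f + w.iConvexComb g := by
  simp [Finsupp.sum, mul_add, Finset.sum_add_distrib]

lemma iConvexComb_indicator [DecidableEq I] (w : StdSimplex ℝ I) (a : I) (c : ℝ) :
    (w.iConvexComb fun i => if i = a then c else 0) = w.weights a * c := by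
  simp +contextual

lemma iConvexComb_dirac (w : StdSimplex ℝ I) : w.iConvexComb single = w := by
  classical
  ext j
  rw [weights_iConvexComb_apply]
  simpa [Finsupp.single_apply] using iConvexComb_indicator w j 1

lemma map_id_fun (w : StdSimplex ℝ I) : (w.map fun i => i) = w := w.map_id

lemma map_congr {w : StdSimplex ℝ I} {f g : I → J} (h : ∀ i, w.weights i ≠ 0 → f i = g i) :
    w.map f = w.map g := by
  ext1
  exact Finsupp.mapDomain_congr fun i hi => h i (by simpa using hi)

lemma exists_of_weights_map_ne_zero {w : StdSimplex ℝ I} {f : I → J} {j : J}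
    (h : (w.map f).weights j ≠ 0) : ∃ i, w.weights i ≠ 0 ∧ f i = j := by
  classical
  simpa using Finsupp.mapDomain_support (Finsupp.mem_support_iff.2 h)

/-- Weights are non-negative, so nothing cancels: the indicator of `i` lies below that of its fibre.
-/
lemma weights_map_ne_zero {w : StdSimplex ℝ I} (f : I → J) {i : I} (hi : w.weights i ≠ 0) :
    (w.map f).weights (f i) ≠ 0 := by
  classical
  intro h
  have h1 : (w.map f).weights (f i) = w.iConvexComb fun k => if f k = f i then 1 else 0 := by
    rw [← iConvexComb_map w f (fun b => if b = f i then (1 : ℝ) else 0),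
      iConvexComb_indicator, mul_one]
  have h2 : (w.iConvexComb fun k => if k = i then (1 : ℝ) else 0) ≤
      w.iConvexComb fun k => if f k = f i then 1 else 0 :=
    iConvexComb_mono fun k _ => by
      by_cases hk : k = i
      · simp [hk]
      · rw [if_neg hk]; split_ifs <;> norm_num
  rw [← h1, h, iConvexComb_indicator, mul_one] at h2
  exact hi (le_antisymm h2 (weights_nonneg i))

/-- A distribution is the combination of its conditional distributions on the fibres of a map. -/
lemma exists_fibre (w : StdSimplex ℝ I) (f : I → J) :
    ∃ κ : J → StdSimplex ℝ I, (w.map f).iConvexComb κ = w ∧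
      ∀ i, w.weights i ≠ 0 → ∀ i', (κ (f i)).weights i' ≠ 0 → f i' = f i ∧ w.weights i' ≠ 0 := by
  classical
  have h : ∀ j, ∃ k : StdSimplex ℝ I, (∀ i, w.weights i ≠ 0 → f i = j →
      ∀ i', (k.weights i' ≠ 0 → f i' = j ∧ w.weights i' ≠ 0) ∧
        (w.map f).weights j * k.weights i' = if f i' = j then w.weights i' else 0) := by
    intro j
    by_cases hj : ∃ x ∈ f ⁻¹' {j}, w.weights x ≠ 0
    · refine ⟨w.restrict _ hj, fun i hi hij i' => ⟨fun h' => ?_, ?_⟩⟩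
      · have : i' ∈ (w.restrict _ hj).weights.support :=
          Finsupp.mem_support_iff.2 h'
        rw [support_weights_restrict] at this
        simp at this; tauto
      · have e : (w.map f).weights j =
            (w.weights.filter (· ∈ f ⁻¹' {j})).sum fun _ r => r := by
          simp [Finsupp.mapDomain, Finsupp.single_apply, Finsupp.sum, Finset.sum_filter]
          refine Finset.sum_congr rfl fun x _ => ?_
          by_cases hx : f x = j <;> simp [hx]
        have p : 0 < (w.weights.filter (· ∈ f ⁻¹' {j})).sum fun _ r => r := by
          refine Finset.sum_pos (fun x hx => ?_) ⟨i, by simpa [hi] using hij⟩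
          simp at hx
          rw [Finsupp.filter_apply_pos _ _ (by simpa using hx.2)]
          exact lt_of_le_of_ne (by simp) (Ne.symm hx.1)
        rw [weights_restrict, e]
        simp only [Finsupp.smul_apply, smul_eq_mul]
        rw [mul_inv_cancel_left₀ p.ne']
        simp [Finsupp.filter_apply]
    -- A fibre of mass zero has no conditional distribution; any value serves.
    · refine ⟨w, fun i hi hij => (hj ⟨i, hij, hi⟩).elim⟩
  choose κ hκ using h
  refine ⟨κ, ?_, fun i hi i' h' => (hκ (f i) i hi rfl i').1 h'⟩
  ext i'
  rw [weights_iConvexComb_apply]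
  have : ((w.map f).iConvexComb fun j => (κ j).weights i') =
      w.iConvexComb fun i => if i = i' then 1 else 0 := by
    rw [iConvexComb_eq_sum]
    simp only [smul_eq_mul, Finsupp.sum]
    rw [Finset.sum_congr rfl (g := fun j => if f i' = j then w.weights i' else 0)]
    · rw [iConvexComb_indicator, Finset.sum_ite_eq]
      by_cases h0 : w.weights i' = 0
      · simp [h0]
      · have := weights_map_ne_zero f h0
        rw [if_pos (by simpa using this)]; simp
    · intro j hj
      obtain ⟨i, hi, hij⟩ := exists_of_weights_map_ne_zero (Finsupp.mem_support_iff.1 hj)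
      exact (hκ j i hi hij i').2
  rw [this, iConvexComb_indicator, mul_one]

end Convexity.StdSimplex

/-! ### The Kantorovich lifting -/

section Kantorovich

variable {A : Type u} {d : A → A → ℝ}

lemma coup_nonempty (φ ψ : Distr A) : (Coup φ ψ).Nonempty := by
  -- The independent coupling.
  refine ⟨φ.iConvexComb fun a => ψ.map fun b => (a, b), ?_, ?_⟩
  · rw [map_iConvexComb]
    simp only [Function.comp_def, StdSimplex.map_map, StdSimplex.map_const]
    exact φ.iConvexComb_dirac
  · rw [map_iConvexComb]
    simp only [Function.comp_def, StdSimplex.map_map]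
    simp [StdSimplex.map_id_fun]

lemma kantorovich_eq (φ ψ : Distr A) :
    kantorovich d φ ψ = ⨅ ω : Coup φ ψ, ω.1.iConvexComb fun p => d p.1 p.2 := by
  simp [kantorovich]

lemma kantorovich_le (h0 : ∀ a b, 0 ≤ d a b) {φ ψ : Distr A} {ω : Distr (A × A)}
    (hω : ω ∈ Coup φ ψ) : kantorovich d φ ψ ≤ ω.iConvexComb fun p => d p.1 p.2 := by
  rw [kantorovich_eq]
  refine ciInf_le ⟨0, ?_⟩ (⟨ω, hω⟩ : Coup φ ψ)
  rintro _ ⟨ω, rfl⟩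
  exact ω.1.iConvexComb_nonneg fun p => h0 _ _

lemma kantorovich_nonneg (h0 : ∀ a b, 0 ≤ d a b) (φ ψ : Distr A) : 0 ≤ kantorovich d φ ψ := by
  rw [kantorovich_eq]
  exact Real.iInf_nonneg fun ω => ω.1.iConvexComb_nonneg fun p => h0 _ _

lemma exists_coup_lt {φ ψ : Distr A} {r : ℝ} (h : kantorovich d φ ψ < r) :
    ∃ ω ∈ Coup φ ψ, (ω.iConvexComb fun p => d p.1 p.2) < r := by
  rw [kantorovich_eq] at h
  have : Nonempty (Coup φ ψ) := (coup_nonempty φ ψ).to_subtype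
  obtain ⟨ω, hω⟩ := exists_lt_of_ciInf_lt h
  exact ⟨ω.1, ω.2, hω⟩

/-- A number below the cost of every coupling is below the Kantorovich distance. -/
lemma le_kantorovich {φ ψ : Distr A} {r : ℝ}
    (h : ∀ ω ∈ Coup φ ψ, r ≤ ω.iConvexComb fun p => d p.1 p.2) : r ≤ kantorovich d φ ψ := by
  refine le_of_forall_gt fun c hc => ?_
  obtain ⟨ω, hω, hlt⟩ := exists_coup_lt hc
  exact (h ω hω).trans_lt hlt

/-- A mixture of nearly optimal couplings couples the mixtures. -/
lemma kantorovich_iConvexComb_le (h0 : ∀ a b, 0 ≤ d a b) {I : Type*} (w : StdSimplex ℝ I)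
    (φ ψ : I → Distr A) :
    kantorovich d (w.iConvexComb φ) (w.iConvexComb ψ) ≤
      w.iConvexComb fun i => kantorovich d (φ i) (ψ i) := by
  refine le_of_forall_pos_le_add fun ε hε => ?_
  choose ω hω hlt using fun i => exists_coup_lt (lt_add_of_pos_right (kantorovich d (φ i) (ψ i)) hε)
  have hc : w.iConvexComb ω ∈ Coup (w.iConvexComb φ) (w.iConvexComb ψ) := by
    constructor <;> rw [map_iConvexComb] <;> congr 1 <;> funext i
    exacts [(hω i).1, (hω i).2]
  refine (kantorovich_le h0 hc).trans ?_
  rw [← iConvexComb_assoc]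
  refine (StdSimplex.iConvexComb_mono fun i _ => (hlt i).le).trans ?_
  rw [StdSimplex.iConvexComb_add, iConvexComb_const]

lemma kantorovich_map_le {B : Type u} {e : B → B → ℝ}
    (h0' : ∀ a b, 0 ≤ e a b) (f : A → B) (hf : ∀ a b, e (f a) (f b) ≤ d a b) (φ ψ : Distr A) :
    kantorovich e (φ.map f) (ψ.map f) ≤ kantorovich d φ ψ := by
  refine le_kantorovich fun ω hω => ?_
  have hc : ω.map (Prod.map f f) ∈ Coup (φ.map f) (ψ.map f) := by
    constructor
    · rw [← hω.1]; simp [StdSimplex.map_map]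
    · rw [← hω.2]; simp [StdSimplex.map_map]
  refine (kantorovich_le h0' hc).trans ?_
  rw [iConvexComb_map]
  exact StdSimplex.iConvexComb_mono fun p _ => hf _ _

lemma kantorovich_self (h0 : ∀ a b, 0 ≤ d a b) (hd : ∀ a, d a a = 0) (φ : Distr A) :
    kantorovich d φ φ = 0 := by
  refine le_antisymm ?_ (kantorovich_nonneg h0 _ _)
  have hc : φ.map (fun a => (a, a)) ∈ Coup φ φ := by
    constructor <;> simp [StdSimplex.map_map, StdSimplex.map_id_fun]
  refine (kantorovich_le h0 hc).trans ?_
  rw [iConvexComb_map]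
  simp only [hd, iConvexComb_const, le_refl]

lemma kantorovich_le_one (h0 : ∀ a b, 0 ≤ d a b) (h1 : ∀ a b, d a b ≤ 1) (φ ψ : Distr A) :
    kantorovich d φ ψ ≤ 1 := by
  obtain ⟨ω, hω⟩ := coup_nonempty φ ψ
  refine (kantorovich_le h0 hω).trans ?_
  simpa using StdSimplex.iConvexComb_mono (w := ω) (g := fun _ => 1) fun p _ => h1 p.1 p.2

lemma kantorovich_comm_le (h0 : ∀ a b, 0 ≤ d a b) (hs : ∀ a b, d a b = d b a) (φ ψ : Distr A) :
    kantorovich d φ ψ ≤ kantorovich d ψ φ := by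
  refine le_kantorovich fun ω hω => ?_
  have hc : ω.map Prod.swap ∈ Coup φ ψ := by
    constructor
    · rw [← hω.2]; simp [StdSimplex.map_map]
    · rw [← hω.1]; simp [StdSimplex.map_map]
  refine (kantorovich_le h0 hc).trans ?_
  rw [iConvexComb_map]
  exact StdSimplex.iConvexComb_mono fun p _ => (hs _ _).le

/-- Couplings with a common marginal are the marginals of a distribution on triples. -/
lemma exists_gluing {φ ψ χ : Distr A} {ω ω' : Distr (A × A)} (hω : ω ∈ Coup φ ψ)
    (hω' : ω' ∈ Coup ψ χ) :
    ∃ τ : StdSimplex ℝ (A × A × A), τ.map (fun t => (t.1, t.2.1)) = ω ∧ τ.map Prod.snd = ω' := by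
  obtain ⟨κ, hκ, hs⟩ := ω'.exists_fibre Prod.fst
  rw [hω'.1] at hκ
  -- Draw `(a, b)` from `ω`, then the third point from `ω'` conditioned on its first coordinate
  -- being `b`.
  refine ⟨ω.iConvexComb fun p => (κ p.2).map fun q => (p.1, p.2, q.2), ?_, ?_⟩
  · rw [map_iConvexComb]
    simp only [Function.comp_def, StdSimplex.map_map, StdSimplex.map_const]
    exact ω.iConvexComb_dirac
  · rw [map_iConvexComb]
    simp only [Function.comp_def, StdSimplex.map_map]
    rw [← iConvexComb_map ω Prod.snd (fun b => (κ b).map fun q => (b, q.2)), hω.2]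
    conv_rhs => rw [← hκ]
    refine iConvexComb_congr fun b hb => ?_
    rw [← hω'.1] at hb
    obtain ⟨q, hq, rfl⟩ := StdSimplex.exists_of_weights_map_ne_zero hb
    conv_rhs => rw [← (κ q.1).map_id_fun]
    exact StdSimplex.map_congr fun q' hq' => Prod.ext (hs q hq q' hq').1.symm rfl

lemma kantorovich_triangle (h0 : ∀ a b, 0 ≤ d a b) (ht : ∀ a b c, d a b ≤ d a c + d c b)
    (φ ψ χ : Distr A) : kantorovich d φ χ ≤ kantorovich d φ ψ + kantorovich d ψ χ := by
  refine le_of_forall_pos_le_add fun ε hε => ?_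
  obtain ⟨ω, hω, hlt⟩ := exists_coup_lt (lt_add_of_pos_right (kantorovich d φ ψ) (half_pos hε))
  obtain ⟨ω', hω', hlt'⟩ := exists_coup_lt (lt_add_of_pos_right (kantorovich d ψ χ) (half_pos hε))
  obtain ⟨τ, rfl, rfl⟩ := exists_gluing hω hω'
  have hc : τ.map (fun t => (t.1, t.2.2)) ∈ Coup φ χ := by
    constructor
    · rw [← hω.1]; simp [StdSimplex.map_map]
    · rw [← hω'.2]; simp [StdSimplex.map_map]
  rw [iConvexComb_map] at hlt hlt'
  refine (kantorovich_le h0 hc).trans ?_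
  rw [iConvexComb_map]
  refine (StdSimplex.iConvexComb_mono fun t _ => ht _ _ t.2.1).trans ?_
  rw [StdSimplex.iConvexComb_add]
  linarith

/-- The Kantorovich distance bounds the difference of the weights of an isolated point. -/
lemma mul_sub_le_kantorovich (h0 : ∀ a b, 0 ≤ d a b) 
    {a : A} {δ : ℝ} (hδ0 : 0 ≤ δ) {φ ψ : Distr A} {F : Set A} (hδ : ∀ b ∈ F, b ≠ a → δ ≤ d a b)
    (hφ : ∀ b, φ.weights b ≠ 0 → b ∈ F) (hψ : ∀ b, ψ.weights b ≠ 0 → b ∈ F) :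
    δ * (φ.weights a - ψ.weights a) ≤ kantorovich d φ ψ := by
  classical
  refine le_kantorovich fun ω hω => ?_
  have e1 : ∀ χ : Distr A, χ.weights a * δ = χ.iConvexComb fun i => if i = a then δ else 0 :=
    fun χ => (χ.iConvexComb_indicator a δ).symm
  have key : φ.weights a * δ ≤ (ω.iConvexComb fun p => d p.1 p.2) + ψ.weights a * δ := by
    rw [e1, e1]
    conv_lhs => rw [← hω.1, iConvexComb_map]
    conv_rhs => rw [← hω.2, iConvexComb_map]
    rw [← StdSimplex.iConvexComb_add]
    -- Pointwise, `δ · [p.1 = a] ≤ d p.1 p.2 + δ · [p.2 = a]`. Only pairs in `F × F` carry mass, so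
    -- `a` need not be isolated outside `F`.
    refine StdSimplex.iConvexComb_mono fun p hp => ?_
    have h1 : p.1 ∈ F := hφ _ (by rw [← hω.1]; exact StdSimplex.weights_map_ne_zero Prod.fst hp)
    have h2 : p.2 ∈ F := hψ _ (by rw [← hω.2]; exact StdSimplex.weights_map_ne_zero Prod.snd hp)
    by_cases e1 : p.1 = a <;> by_cases e2 : p.2 = a
    · simp [e1, e2, h0]
    · simpa [e1, e2] using hδ _ h2 e2
    · simp only [if_neg e1, if_pos e2]
      exact add_nonneg (h0 _ _) hδ0
    · simp [e1, e2, h0]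
  linarith

end Kantorovich

/-! ### The Hausdorff lifting -/

section Hausdorff

variable {A : Type u} {d : A → A → ℝ} {S T : Set A}

/-- Partners up to `ε` suffice, so neither nearest points nor optimal couplings have to exist. -/
lemma hausdorff_le (h0 : ∀ a b, 0 ≤ d a b) (hS : S.Nonempty) (hT : T.Nonempty) {r : ℝ}
    (h : ∀ s ∈ S, ∀ ε > 0, ∃ t ∈ T, d s t ≤ r + ε)
    (h' : ∀ t ∈ T, ∀ ε > 0, ∃ s ∈ S, d s t ≤ r + ε) : hausdorff d S T ≤ r := by
  have := hS.to_subtype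
  have := hT.to_subtype
  refine max_le (ciSup_le fun s => ?_) (ciSup_le fun t => ?_) <;>
    refine le_of_forall_pos_le_add fun ε hε => ?_
  · obtain ⟨t, ht, hle⟩ := h s s.2 ε hε
    refine (ciInf_le ⟨0, ?_⟩ (⟨t, ht⟩ : T)).trans hle
    rintro _ ⟨t, rfl⟩
    exact h0 _ _
  · obtain ⟨s, hs, hle⟩ := h' t t.2 ε hε
    refine (ciInf_le ⟨0, ?_⟩ (⟨s, hs⟩ : S)).trans hle
    rintro _ ⟨s, rfl⟩
    exact h0 _ _

lemma hausdorff_nonneg (h0 : ∀ a b, 0 ≤ d a b) : 0 ≤ hausdorff d S T :=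
  le_max_of_le_left (Real.iSup_nonneg fun _ => Real.iInf_nonneg fun _ => h0 _ _)

lemma hausdorff_comm (hs : ∀ a b, d a b = d b a) : hausdorff d S T = hausdorff d T S := by
  unfold hausdorff
  rw [max_comm]
  simp only [hs]

lemma exists_lt_hausdorff_add (h0 : ∀ a b, 0 ≤ d a b) (h1 : ∀ a b, d a b ≤ 1) (hT : T.Nonempty)
    {s : A} (hs : s ∈ S) {ε : ℝ} (hε : 0 < ε) : ∃ t ∈ T, d s t < hausdorff d S T + ε := by
  have := hT.to_subtype
  -- An unbounded real supremum would default to `0`; the bound `1` on `d` excludes this.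
  have hb : BddAbove (Set.range fun s : S => ⨅ t : T, d s t) := by
    refine ⟨1, ?_⟩
    rintro _ ⟨s, rfl⟩
    refine (ciInf_le ⟨0, ?_⟩ (⟨_, hT.some_mem⟩ : T)).trans (h1 _ _)
    rintro _ ⟨t, rfl⟩
    exact h0 _ _
  have h : (⨅ t : T, d s t) < hausdorff d S T + ε :=
    ((le_ciSup hb ⟨s, hs⟩).trans (le_max_left _ _)).trans_lt (lt_add_of_pos_right _ hε)
  obtain ⟨t, ht⟩ := exists_lt_of_ciInf_lt h
  exact ⟨t, t.2, ht⟩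

end Hausdorff

/-! ### Finitely generated convex sets are closed -/

section Closed

variable {A : Type u}

/-- Confines the hull to finitely many points, among which each point is isolated. -/
lemma exists_support_convexHull {B : Set (Distr A)} (hB : B.Finite) :
    ∃ F : Finset A, ∀ ψ ∈ Convexity.convexHull ℝ B, ∀ a, ψ.weights a ≠ 0 → a ∈ F := by
  classical
  refine ⟨hB.toFinset.biUnion fun φ => φ.weights.support, fun ψ hψ => ?_⟩
  refine Convexity.mem_convexHull_iff.1 hψ
    {ψ | ∀ a, ψ.weights a ≠ 0 → a ∈ hB.toFinset.biUnion fun φ => φ.weights.support} ?_ ?_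
  · intro φ hφ a ha
    simp only [Finset.mem_biUnion, Set.Finite.mem_toFinset]
    exact ⟨φ, hφ, by simpa using ha⟩
  · refine .of_convexCombPair_mem fun s t hs ht hst x hx y hy a ha => ?_
    by_contra hc
    refine ha ?_
    have hxa : x.weights a = 0 := by_contra fun h => hc (hx a h)
    have hya : y.weights a = 0 := by_contra fun h => hc (hy a h)
    simp [hxa, hya]

/-- In the product space `A → ℝ` this is the linear convex hull of a finite set, which is compact.
-/
lemma isClosed_weights_convexHull {B : Set (Distr A)} (hB : B.Finite) :
    IsClosed ((fun φ : Distr A => (φ.weights : A → ℝ)) '' Convexity.convexHull ℝ B) := by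
  have e : (fun φ : Distr A => (φ.weights : A → ℝ)) '' Convexity.convexHull ℝ B =
      _root_.convexHull ℝ ((fun φ : Distr A => (φ.weights : A → ℝ)) '' B) := by
    refine Set.Subset.antisymm ?_ ?_
    · rw [Set.image_subset_iff]
      refine Convexity.convexHull_min (fun φ hφ => subset_convexHull ℝ _ ⟨φ, hφ, rfl⟩) ?_
      refine .of_convexCombPair_mem fun s t hs ht hst x hx y hy => ?_
      have := convex_convexHull ℝ _ hx hy hs ht hst
      simpa using! this
    · refine _root_.convexHull_min (Set.image_mono Convexity.subset_convexHull_self) ?_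
      rintro _ ⟨x, hx, rfl⟩ _ ⟨y, hy, rfl⟩ s t hs ht hst
      refine ⟨convexCombPair s t hs ht hst x y,
        Convexity.IsConvexSet.convexHull.convexCombPair_mem hx hy hs ht hst, ?_⟩
      ext a; simp
  rw [e]
  exact ((hB.image _).isCompact_convexHull ℝ).isClosed

lemma exists_isolating {d : A → A → ℝ} (hd : IsOneBoundedMetric d) (F : Finset A) (a : A) :
    ∃ δ > 0, ∀ b ∈ F, b ≠ a → δ ≤ d a b := by
  classical
  induction F using Finset.induction_on with
  | empty => exact ⟨1, one_pos, by simp⟩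
  | insert c F _ ih =>
    obtain ⟨δ, hδ, h⟩ := ih
    by_cases hc : c = a
    · exact ⟨δ, hδ, fun b hb hba => h b (by grind) hba⟩
    · have : 0 < d a c := lt_of_le_of_ne (hd.nonneg _ _)
        fun h => hc ((hd.eq_zero_iff _ _).1 h.symm).symm
      refine ⟨min δ (d a c), lt_min hδ this, fun b hb hba => ?_⟩
      obtain rfl | hb := Finset.mem_insert.1 hb
      exacts [min_le_right _ _, (min_le_left _ _).trans (h b hb hba)]

/-- On a finite set of points Kantorovich convergence forces pointwise convergence of the weights,
and the hull is closed for the latter. -/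
lemma mem_convexHull_of_kantorovich_lt {d : A → A → ℝ} (hd : IsOneBoundedMetric d)
    {B : Set (Distr A)} (hB : B.Finite) {φ : Distr A}
    (h : ∀ ε > 0, ∃ ψ ∈ Convexity.convexHull ℝ B, kantorovich d φ ψ < ε) :
    φ ∈ Convexity.convexHull ℝ B := by
  classical
  obtain ⟨F, hF⟩ := exists_support_convexHull hB
  choose ψ hψ hlt using fun n : ℕ => h (1 / ((n : ℝ) + 1)) (by positivity)
  have hlim : Filter.Tendsto (fun n => ((ψ n).weights : A → ℝ)) Filter.atTop
      (nhds (φ.weights : A → ℝ)) := by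
    refine tendsto_pi_nhds.2 fun a => ?_
    obtain ⟨δ, hδ, hδa⟩ := exists_isolating hd (F ∪ φ.weights.support) a
    have hφ : ∀ b, φ.weights b ≠ 0 → b ∈ F ∪ φ.weights.support := fun b hb => by simp [hb]
    have hψ' : ∀ n b, (ψ n).weights b ≠ 0 → b ∈ F ∪ φ.weights.support := fun n b hb => by
      simp [hF _ (hψ n) b hb]
    rw [tendsto_iff_dist_tendsto_zero]
    refine squeeze_zero (g := fun n : ℕ => δ⁻¹ * (1 / ((n : ℝ) + 1))) (fun _ => dist_nonneg) ?_ ?_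
    · intro n
      rw [le_inv_mul_iff₀ hδ]
      refine le_trans ?_ (hlt n).le
      rw [Real.dist_eq]
      rcases abs_cases ((ψ n).weights a - φ.weights a) with ⟨e, _⟩ | ⟨e, _⟩ <;> rw [e]
      · exact (mul_sub_le_kantorovich hd.nonneg hδ.le (F := (F ∪ φ.weights.support : Finset A))
          hδa (hψ' n) hφ).trans (kantorovich_comm_le hd.nonneg hd.symm _ _)
      · rw [neg_sub]
        exact mul_sub_le_kantorovich hd.nonneg hδ.le (F := (F ∪ φ.weights.support : Finset A))
          hδa hφ (hψ' n)
    · simpa using tendsto_one_div_add_atTop_nhds_zero_nat.const_mul δ⁻¹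
  obtain ⟨φ', hφ', e⟩ := (isClosed_weights_convexHull hB).mem_of_tendsto hlim
    (.of_forall fun n => ⟨_, hψ n, rfl⟩)
  rwa [← StdSimplex.ext (DFunLike.coe_injective e)]

end Closed

/-! ### The Hausdorff–Kantorovich distance is a metric -/

section Metric

variable {A : Type u}

lemma isOneBoundedMetric_optionDist {d : A → A → ℝ} (hd : IsOneBoundedMetric d) :
    IsOneBoundedMetric (optionDist d) where
  nonneg a b := by cases a <;> cases b <;> simp [optionDist, hd.nonneg]
  le_one a b := by cases a <;> cases b <;> simp [optionDist, hd.le_one]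
  eq_zero_iff a b := by cases a <;> cases b <;> simp [optionDist, hd.eq_zero_iff]
  symm a b := by cases a <;> cases b <;> simp [optionDist, hd.symm]
  triangle a b c := by
    cases a <;> cases b <;> cases c <;>
      simp [optionDist, hd.triangle, hd.nonneg]
    -- Two points of `A` compared through `⋆`: here `d x y ≤ 1 + 1` needs the bound on `d`.
    rename_i x y
    linarith [hd.le_one x y]

lemma OneMet.isOneBoundedMetric (X : OneMet.{u}) :
    IsOneBoundedMetric fun x y : X.carrier => dist x y where
  nonneg _ _ := dist_nonneg
  le_one := X.dist_le_one
  eq_zero_iff _ _ := dist_eq_zero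
  symm := dist_comm
  triangle a b c := dist_triangle a c b

lemma hausKant_isOneBoundedMetric (X : OneMet.{u}) : IsOneBoundedMetric (hausKant X) := by
  have hd := isOneBoundedMetric_optionDist X.isOneBoundedMetric
  have h0 := kantorovich_nonneg hd.nonneg
  have h1 := kantorovich_le_one hd.nonneg hd.le_one
  have hs : ∀ φ ψ, kantorovich (optionDist fun x y : X.carrier => dist x y) φ ψ =
      kantorovich (optionDist fun x y : X.carrier => dist x y) ψ φ := fun φ ψ =>
    (kantorovich_comm_le hd.nonneg hd.symm _ _).antisymm
      (kantorovich_comm_le hd.nonneg hd.symm _ _)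
  have ne : ∀ S : Cdown X.carrier, S.toSet.Nonempty := fun S => S.2.1.nonempty
  have hself : ∀ S, hausKant X S S = 0 := fun S => by
    refine le_antisymm (hausdorff_le h0 (ne S) (ne S) ?_ ?_) (hausdorff_nonneg h0) <;>
    · intro φ hφ ε hε
      exact ⟨φ, hφ, by
        rw [kantorovich_self hd.nonneg fun a => (hd.eq_zero_iff a a).2 rfl]; linarith⟩
  have hsymm : ∀ S T, hausKant X S T = hausKant X T S := fun S T => hausdorff_comm hs
  -- At distance zero each point of `S` is a Kantorovich limit of points of `T`, and `T` is closed.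
  have hsub : ∀ S T, hausKant X S T = 0 → S.toSet ⊆ T.toSet := by
    intro S T h φ hφ
    obtain ⟨B, hB, hT⟩ := T.2.1.finGen
    change T.toSet = _ at hT
    rw [hT]
    refine mem_convexHull_of_kantorovich_lt hd hB fun ε hε => ?_
    obtain ⟨ψ, hψ, hlt⟩ := exists_lt_hausdorff_add h0 h1 (ne T) hφ hε
    exact ⟨ψ, hT ▸ hψ, by rwa [show hausdorff _ _ _ = 0 from h, zero_add] at hlt⟩
  have htri : ∀ S T U, ∀ φ ∈ S.toSet, ∀ ε > 0, ∃ ψ ∈ T.toSet,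
      kantorovich (optionDist fun x y : X.carrier => dist x y) φ ψ ≤
        hausKant X S U + hausKant X U T + ε := by
    intro S T U φ hφ ε hε
    obtain ⟨χ, hχ, hlt⟩ := exists_lt_hausdorff_add h0 h1 (ne U) hφ (half_pos hε)
    obtain ⟨ψ, hψ, hlt'⟩ := exists_lt_hausdorff_add h0 h1 (ne T) hχ (half_pos hε)
    refine ⟨ψ, hψ, (kantorovich_triangle hd.nonneg hd.triangle φ χ ψ).trans ?_⟩
    unfold hausKant
    linarith
  exact
    { nonneg := fun S T => hausdorff_nonneg h0
      le_one := fun S T => by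
        refine hausdorff_le h0 (ne S) (ne T) ?_ ?_ <;> intro φ _ ε hε
        · exact ⟨_, (ne T).some_mem, (h1 _ _).trans (by linarith)⟩
        · exact ⟨_, (ne S).some_mem, (h1 _ _).trans (by linarith)⟩
      eq_zero_iff := fun S T => ⟨fun h => Subtype.ext
        ((hsub S T h).antisymm (hsub T S (hsymm S T ▸ h))), fun h => h ▸ hself S⟩
      symm := hsymm
      triangle := fun S T U => by
        refine hausdorff_le h0 (ne S) (ne T) (htri S T U) fun ψ hψ ε hε => ?_
        obtain ⟨φ, hφ, hle⟩ := htri T S U ψ hψ ε hε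
        refine ⟨φ, hφ, ?_⟩
        rw [hs, hsymm S U, hsymm U T]
        linarith }

end Metric

/-! ### `⊥`-closed sets -/

namespace Distr

variable {A B : Type u}

/-- The kernel that keeps a point `a` with probability `c a`. -/
noncomputable def keep (c : A → Set.Icc (0 : ℝ) 1) : Option A → Distr (Option A)
  | some a => StdSimplex.duple (some a) none (c a).2.1 (sub_nonneg.2 (c a).2.2) (add_sub_cancel _ _)
  | none => StdSimplex.single none

lemma weights_iConvexComb_keep (φ : Distr (Option A)) (c : A → Set.Icc (0 : ℝ) 1) (a : A) :
    (φ.iConvexComb (keep c)).weights (some a) = c a * φ.weights (some a) := by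
  classical
  rw [StdSimplex.weights_iConvexComb_apply, mul_comm, ← StdSimplex.iConvexComb_indicator]
  congr 1
  funext o
  cases o <;> simp [keep, Finsupp.single_apply]
  aesop

/-- The mass at `⋆` is what the other weights leave of the total `1`. -/
lemma ext_some {φ ψ : Distr (Option A)}
    (h : ∀ a, φ.weights (some a) = ψ.weights (some a)) : φ = ψ := by
  classical
  have e : ∀ χ : Distr (Option A), χ.weights none = 1 - χ.weights.some.sum fun _ r => r := by
    intro χ
    rw [eq_sub_iff_add_eq, ← χ.total, Finsupp.sum_option_index] <;> simp
  have hs : φ.weights.some = ψ.weights.some := by ext a; simpa using h a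
  ext o
  cases o with
  | none => rw [e, e, hs]
  | some a => exact h a

lemma exists_keep_of_le {φ ψ : Distr (Option A)}
    (h : ∀ a, ψ.weights (some a) ≤ φ.weights (some a)) : ∃ c, ψ = φ.iConvexComb (keep c) := by
  -- Where `φ` vanishes the quotient defaults to `0`, harmlessly, as `ψ` vanishes there too.
  refine ⟨fun a => ⟨ψ.weights (some a) / φ.weights (some a),
    div_nonneg (ψ.weights_nonneg _) (φ.weights_nonneg _),
    div_le_one_of_le₀ (h a) (φ.weights_nonneg _)⟩, ext_some fun a => ?_⟩
  rw [weights_iConvexComb_keep]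
  by_cases h0 : φ.weights (some a) = 0
  · exact (le_antisymm ((h a).trans_eq h0) (ψ.weights_nonneg _)).trans ((congrArg _ h0).trans (mul_zero _)).symm
  · exact (div_mul_cancel₀ _ h0).symm

lemma keep_comp_map (f : A → B) (c : B → Set.Icc (0 : ℝ) 1) (o : Option A) :
    keep c (o.map f) = (keep (c ∘ f) o).map (Option.map f) := by
  cases o <;> simp [keep]

end Distr

open Distr

section BotClosed

variable {A B : Type u} {S : Set (Distr (Option A))}

/-- Turns an order condition into stability under the kernels `keep c`, to which associativity of
combinations applies. -/
lemma isBotClosed_iff :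
    IsBotClosed S ↔ ∀ φ ∈ S, ∀ c, φ.iConvexComb (keep c) ∈ S := by
  refine ⟨fun h φ hφ c => h φ hφ _ fun a => ?_, fun h φ hφ ψ hle => ?_⟩
  · rw [weights_iConvexComb_keep]
    exact mul_le_of_le_one_left (by simp) (c a).2.2
  · obtain ⟨c, rfl⟩ := exists_keep_of_le hle
    exact h φ hφ c

lemma isFGConvex_singleton (φ : Distr A) : IsFGConvex {φ} where
  nonempty := ⟨φ, rfl⟩
  convex := .singleton
  finGen := ⟨{φ}, Set.finite_singleton _, by simp⟩

lemma isFGConvex_cdownStar (o : Option (Cdown A)) : IsFGConvex (cdownStar o) := by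
  cases o with
  | none => exact isFGConvex_singleton _
  | some U => exact U.2.1

lemma isBotClosed_cdownStar (o : Option (Cdown A)) : IsBotClosed (cdownStar o) := by
  cases o with
  | none =>
    rw [isBotClosed_iff]
    rintro _ rfl c
    rw [iConvexComb_single]
    rfl
  | some U => exact U.2.2

lemma single_none_mem (U : Cdown A) : StdSimplex.single none ∈ U.toSet := by
  obtain ⟨φ, hφ⟩ := U.2.1.nonempty
  exact U.2.2 φ hφ _ fun a => by simp

/-! ### The functor and the unit -/

lemma isFGConvex_cdownMap (f : A → B) (h : IsFGConvex S) : IsFGConvex (cdownMap f S) where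
  nonempty := h.nonempty.image _
  convex := h.convex.image (StdSimplex.isAffineMap_map ℝ _)
  finGen := by
    obtain ⟨G, hG, rfl⟩ := h.finGen
    exact ⟨_, hG.image _, (StdSimplex.isAffineMap_map ℝ _).image_convexHull _⟩

lemma isBotClosed_cdownMap (f : A → B) (h : IsBotClosed S) : IsBotClosed (cdownMap f S) := by
  rw [isBotClosed_iff] at h ⊢
  rintro _ ⟨φ, hφ, rfl⟩ c
  -- Discarding mass after relabelling by `f` equals discarding with `c ∘ f` before it.
  refine ⟨_, h φ hφ (c ∘ f), ?_⟩
  simp only [iConvexComb_map, keep_comp_map]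
  exact map_iConvexComb _ _

/-- The action of the functor on maps. -/
def Cdown.map (f : A → B) (U : Cdown A) : Cdown B :=
  ⟨cdownMap f U.toSet, isFGConvex_cdownMap f U.2.1, isBotClosed_cdownMap f U.2.2⟩

lemma Cdown.ext {U V : Cdown A} (h : U.toSet = V.toSet) : U = V := Subtype.ext h

lemma isConvexSet_cdownUnit (x : A) : IsConvexSet ℝ (cdownUnit x) := by
  refine .of_convexCombPair_mem ?_
  rintro s t hs ht hst _ ⟨p, hp0, hp1, rfl⟩ _ ⟨q, hq0, hq1, rfl⟩
  refine ⟨s * p + t * q, by positivity, by nlinarith, ext_some fun a => ?_⟩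
  by_cases h : x = a <;> simp [h]

lemma isFGConvex_cdownUnit (x : A) : IsFGConvex (cdownUnit x) where
  nonempty := ⟨_, 1, zero_le_one, le_rfl, rfl⟩
  convex := isConvexSet_cdownUnit x
  finGen := by
    refine ⟨{StdSimplex.single (some x), StdSimplex.single none}, by simp,
      Set.Subset.antisymm ?_ (Convexity.convexHull_min ?_ (isConvexSet_cdownUnit x))⟩
    · rintro _ ⟨p, hp0, hp1, rfl⟩
      have h1 : StdSimplex.single (some x) ∈ Convexity.convexHull ℝ
          ({StdSimplex.single (some x), StdSimplex.single none} : Set (Distr (Option A))) :=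
        Convexity.subset_convexHull_self (by simp)
      have h2 : StdSimplex.single none ∈ Convexity.convexHull ℝ
          ({StdSimplex.single (some x), StdSimplex.single none} : Set (Distr (Option A))) :=
        Convexity.subset_convexHull_self (by simp)
      have := Convexity.IsConvexSet.convexHull.convexCombPair_mem h1 h2 hp0 (sub_nonneg.2 hp1)
        (add_sub_cancel p 1)
      convert this using 1
      ext1
      simp
    · rintro _ (rfl | rfl)
      · exact ⟨1, zero_le_one, le_rfl, ext_some fun a => by simp⟩
      · exact ⟨0, le_rfl, zero_le_one, ext_some fun a => by simp⟩

lemma isBotClosed_cdownUnit (x : A) : IsBotClosed (cdownUnit x) := by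
  rw [isBotClosed_iff]
  rintro _ ⟨p, hp0, hp1, rfl⟩ c
  refine ⟨c x * p, mul_nonneg (c x).2.1 hp0, mul_le_one₀ (c x).2.2 hp0 hp1, ext_some fun a => ?_⟩
  rw [weights_iConvexComb_keep]
  simp only [StdSimplex.weights_duple, Finsupp.add_apply, Finsupp.single_apply]
  by_cases h : x = a <;> simp [h]

/-- The unit. -/
def Cdown.pure (x : A) : Cdown A :=
  ⟨cdownUnit x, isFGConvex_cdownUnit x, isBotClosed_cdownUnit x⟩

/-! ### The multiplication -/

/-- `wms` allows one choice per set, whereas `g` may differ at indices with the same set. Averaging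
`g` over each fibre of `h` stays in the set by convexity. -/
lemma iConvexComb_mem_wms {I : Type*} {w : StdSimplex ℝ I} {h : I → Set (Distr A)}
    {g : I → Distr A} (hc : ∀ i, IsConvexSet ℝ (h i)) (hg : ∀ i, w.weights i ≠ 0 → g i ∈ h i) :
    w.iConvexComb g ∈ wms (w.map h) := by
  obtain ⟨κ, hκ, hs⟩ := w.exists_fibre h
  refine ⟨fun U => (κ U).iConvexComb g, fun U hU => ?_, ?_⟩
  · obtain ⟨i, hi, rfl⟩ := StdSimplex.exists_of_weights_map_ne_zero (Finsupp.mem_support_iff.1 hU)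
    refine (hc i).iConvexComb_mem fun i' hi' => ?_
    obtain ⟨e, hw⟩ := hs i hi i' hi'
    exact e ▸ hg i' hw
  · rw [iConvexComb_assoc, hκ]

/-- Replaces `wms` by selections indexed by `Option (Cdown A)`. This is not mere reindexing, since
`cdownStar` identifies `⋆` with the element `{δ_⋆}` of `Cdown A`. -/
lemma mem_cdownMul {S : Set (Distr (Option (Cdown A)))} {θ : Distr (Option A)} :
    θ ∈ cdownMul S ↔ ∃ Φ ∈ S, ∃ g : Option (Cdown A) → Distr (Option A),
      (∀ o, g o ∈ cdownStar o) ∧ θ = Φ.iConvexComb g := by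
  classical
  simp only [cdownMul, Set.mem_iUnion, exists_prop]
  refine exists_congr fun Φ => and_congr_right fun _ => ⟨?_, ?_⟩
  · rintro ⟨g, hg, rfl⟩
    choose e he using fun o : Option (Cdown A) => (isFGConvex_cdownStar o).nonempty
    refine ⟨fun o => if Φ.weights o = 0 then e o else g (cdownStar o), fun o => ?_, ?_⟩
    · dsimp only
      split_ifs with h
      · exact he o
      · exact hg _ (Finsupp.mem_support_iff.2 (StdSimplex.weights_map_ne_zero cdownStar h))
    · rw [iConvexComb_map]
      exact iConvexComb_congr fun o ho => by simp [ho]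
  · rintro ⟨g, hg, rfl⟩
    exact iConvexComb_mem_wms (fun o => (isFGConvex_cdownStar o).convex) fun o _ => hg o

/-- The choice may depend on `i` and not just on `h i`, as it does for the pairs of a coupling. -/
lemma iConvexComb_mem_cdownMul {S : Set (Distr (Option (Cdown A)))} {I : Type*}
    {w : StdSimplex ℝ I} {h : I → Option (Cdown A)} {g : I → Distr (Option A)}
    (hS : w.map h ∈ S) (hg : ∀ i, g i ∈ cdownStar (h i)) : w.iConvexComb g ∈ cdownMul S := by
  refine Set.mem_biUnion hS ?_
  rw [StdSimplex.map_map]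
  exact iConvexComb_mem_wms (fun i => (isFGConvex_cdownStar _).convex) fun i _ => hg i

/-- A combination of combinations is indexed by pairs. -/
lemma iConvexComb_mem_cdownMul' {S : Set (Distr (Option (Cdown A)))} {I : Type*}
    {w : StdSimplex ℝ I} {Φ : I → Distr (Option (Cdown A))}
    {g : I → Option (Cdown A) → Distr (Option A)}
    (hS : w.iConvexComb Φ ∈ S) (hg : ∀ i o, g i o ∈ cdownStar o) :
    (w.iConvexComb fun i => (Φ i).iConvexComb (g i)) ∈ cdownMul S := by
  rw [iConvexComb_assoc']
  refine iConvexComb_mem_cdownMul (h := Prod.snd) ?_ fun p => hg p.1 p.2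
  rw [map_iConvexComb]
  simpa [Function.comp_def, StdSimplex.map_map, StdSimplex.map_id_fun] using hS

lemma isConvexSet_cdownMul {S : Set (Distr (Option (Cdown A)))} (hS : IsConvexSet ℝ S) :
    IsConvexSet ℝ (cdownMul S) := by
  refine .of_convexCombPair_mem fun s t hs ht hst x hx y hy => ?_
  obtain ⟨Φ, hΦ, g, hg, rfl⟩ := mem_cdownMul.1 hx
  obtain ⟨Ψ, hΨ, k, hk, rfl⟩ := mem_cdownMul.1 hy
  rw [convexCombPair_def]
  -- The binary combination is indexed by `Fin 2`, so each summand keeps its own selection.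
  have := iConvexComb_mem_cdownMul' (w := StdSimplex.duple (0 : Fin 2) 1 hs ht hst)
    (Φ := ![Φ, Ψ]) (g := ![g, k]) (S := S)
    (by rw [← convexCombPair_def]; exact hS.convexCombPair_mem hΦ hΨ hs ht hst)
    (by intro i; fin_cases i; exacts [hg, hk])
  convert this using 2
  rename_i i _
  fin_cases i <;> rfl

lemma isBotClosed_cdownMul (S : Set (Distr (Option (Cdown A)))) : IsBotClosed (cdownMul S) := by
  rw [isBotClosed_iff]
  intro θ hθ c
  obtain ⟨Φ, hΦ, g, hg, rfl⟩ := mem_cdownMul.1 hθ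
  rw [← iConvexComb_assoc]
  exact mem_cdownMul.2 ⟨Φ, hΦ, _,
    fun o => isBotClosed_iff.1 (isBotClosed_cdownStar o) _ (hg o) c, rfl⟩

lemma isAffineMap_iConvexComb {I : Type*} (g : I → Distr A) :
    IsAffineMap ℝ fun w : StdSimplex ℝ I => w.iConvexComb g where
  map_sConvexComb w := by
    rw [← iConvexComb_id', ← iConvexComb_assoc]; rfl

lemma isAffineMap_iConvexComb_update {I : Type*} [DecidableEq I] (w : StdSimplex ℝ I)
    (g : I → Distr A) (i : I) : IsAffineMap ℝ fun x => w.iConvexComb (Function.update g i x) where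
  map_sConvexComb v := by
    change _ = v.iConvexComb _
    rw [iConvexComb_comm]
    congr 1
    funext j
    by_cases h : j = i
    · subst h; simp
    · simp [h]

/-- The combination is affine in each coordinate separately, so generators can be relaxed to hull
points one coordinate at a time; only the finite support matters. -/
lemma iConvexComb_mem_of_generators {I : Type*} {w : StdSimplex ℝ I} {G : I → Set (Distr A)}
    {W : Set (Distr A)} (hW : IsConvexSet ℝ W) (hGW : ∀ g, (∀ i, g i ∈ G i) → w.iConvexComb g ∈ W)
    (hne : ∀ i, (G i).Nonempty) {g : I → Distr A}
    (hg : ∀ i, g i ∈ Convexity.convexHull ℝ (G i)) : w.iConvexComb g ∈ W := by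
  classical
  -- `s` is the set of coordinates already relaxed.
  have key : ∀ s : Finset I, ∀ g : I → Distr A, (∀ i, g i ∈ Convexity.convexHull ℝ (G i)) →
      (∀ i ∉ s, g i ∈ G i) → w.iConvexComb g ∈ W := by
    intro s
    induction s using Finset.induction_on with
    | empty => exact fun g _ hg' => hGW g fun i => hg' i (Finset.notMem_empty i)
    | insert j s _ ih =>
      intro g hg hg'
      have := Convexity.convexHull_min (C := (fun x => w.iConvexComb (Function.update g j x)) ⁻¹' W)
        (s := G j) (fun x hx => ih _ (fun i => ?_) fun i hi => ?_)
        (hW.preimage (isAffineMap_iConvexComb_update w g j)) (hg j)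
      · simpa using this
      · by_cases h : i = j
        · subst h; simpa using Convexity.subset_convexHull_self hx
        · simpa [h] using hg i
      · by_cases h : i = j
        · subst h; simpa using hx
        · simpa [h] using hg' i (by simp [h, hi])
  choose e he using hne
  have := key w.weights.support (fun i => if w.weights i = 0 then e i else g i) (fun i => ?_)
    fun i hi => ?_
  · convert this using 1
    exact iConvexComb_congr fun i hi => by simp [hi]
  · split_ifs
    exacts [Convexity.subset_convexHull_self (he i), hg i]
  · rw [if_pos (by simpa using hi)]
    exact he i

/-- Only the values of `g` on the finite support count, leaving a finite product of finite sets. -/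
lemma finite_iConvexComb {I : Type*} (w : StdSimplex ℝ I) {G : I → Set (Distr A)}
    (hG : ∀ i, (G i).Finite) : {θ | ∃ g, (∀ i, g i ∈ G i) ∧ θ = w.iConvexComb g}.Finite := by
  classical
  by_cases hne : ∃ e : I → Distr A, ∀ i, e i ∈ G i
  · obtain ⟨e, he⟩ := hne
    have hf : {r : w.weights.support → Distr A | ∀ i, r i ∈ G i.1}.Finite :=
      Set.Finite.pi' fun i => hG i
    refine (hf.image fun r => w.iConvexComb fun i =>
      if h : i ∈ w.weights.support then r ⟨i, h⟩ else e i).subset ?_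
    rintro _ ⟨g, hg, rfl⟩
    refine ⟨fun i => g i, fun i => hg i, iConvexComb_congr fun i hi => ?_⟩
    simp [hi]
  · refine Set.Finite.subset Set.finite_empty ?_
    rintro _ ⟨g, hg, rfl⟩
    exact hne ⟨g, hg⟩

/-- Generators are the combinations of a generator `Φ` of `S` along selections of generators of the
sets `cdownStar o`. -/
lemma isFGConvex_cdownMul {S : Set (Distr (Option (Cdown A)))} (hS : IsFGConvex S) :
    IsFGConvex (cdownMul S) where
  nonempty := by
    obtain ⟨Φ, hΦ⟩ := hS.nonempty
    choose e he using fun o : Option (Cdown A) => (isFGConvex_cdownStar o).nonempty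
    exact ⟨_, mem_cdownMul.2 ⟨Φ, hΦ, e, he, rfl⟩⟩
  convex := isConvexSet_cdownMul hS.convex
  finGen := by
    obtain ⟨B, hB, hSB⟩ := hS.finGen
    choose G hG hGo using fun o : Option (Cdown A) => (isFGConvex_cdownStar o).finGen
    have hne : ∀ o, (G o).Nonempty := fun o => by
      have := (isFGConvex_cdownStar o).nonempty
      rwa [hGo, Convexity.convexHull_nonempty] at this
    refine ⟨⋃ Φ ∈ B, {θ | ∃ g, (∀ o, g o ∈ G o) ∧ θ = Φ.iConvexComb g},
      hB.biUnion fun Φ _ => finite_iConvexComb Φ hG, Set.Subset.antisymm ?_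
        (Convexity.convexHull_min ?_ (isConvexSet_cdownMul hS.convex))⟩
    · intro θ hθ
      obtain ⟨Φ, hΦ, g, hg, rfl⟩ := mem_cdownMul.1 hθ
      rw [hSB] at hΦ
      -- For fixed `g` the combination is affine in `Φ`, which reduces `Φ` to a generator.
      refine Convexity.convexHull_min (C := (fun w : Distr (Option (Cdown A)) =>
        w.iConvexComb g) ⁻¹' _) (fun Ψ hΨ => ?_)
        (Convexity.IsConvexSet.convexHull.preimage (isAffineMap_iConvexComb g)) hΦ
      refine iConvexComb_mem_of_generators Convexity.IsConvexSet.convexHull (G := G)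
        (fun k hk => Convexity.subset_convexHull_self ?_) hne fun o => hGo o ▸ hg o
      exact Set.mem_biUnion hΨ ⟨k, hk, rfl⟩
    · refine Set.iUnion₂_subset fun Φ hΦ => ?_
      rintro _ ⟨g, hg, rfl⟩
      refine mem_cdownMul.2 ⟨Φ, hSB ▸ Convexity.subset_convexHull_self hΦ, g, fun o => ?_, rfl⟩
      rw [hGo]
      exact Convexity.subset_convexHull_self (hg o)

/-- The multiplication. -/
def Cdown.join (S : Cdown (Cdown A)) : Cdown A :=
  ⟨cdownMul S.toSet, isFGConvex_cdownMul S.2.1, isBotClosed_cdownMul _⟩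

end BotClosed

/-! ### The monad laws -/

section Laws

variable {A B C : Type u}

lemma cdownStar_map (f : A → B) (o : Option (Cdown A)) :
    cdownStar (o.map (Cdown.map f)) = cdownMap f (cdownStar o) := by
  cases o with
  | none => simp [cdownStar, cdownMap]
  | some U => rfl

/-- Lets `⋆` be treated like any set in the associativity law. -/
lemma mem_cdownStar_join {o : Option (Cdown (Cdown A))} {θ : Distr (Option A)} :
    θ ∈ cdownStar (o.map Cdown.join) ↔ ∃ Φ ∈ cdownStar o,
      ∃ g : Option (Cdown A) → Distr (Option A), (∀ o, g o ∈ cdownStar o) ∧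
        θ = Φ.iConvexComb g := by
  cases o with
  | some V => exact mem_cdownMul
  | none =>
    constructor
    · rintro rfl
      choose e he using fun o : Option (Cdown A) => (isFGConvex_cdownStar o).nonempty
      exact ⟨_, rfl, e, he, by rw [iConvexComb_single]; exact (he none).symm⟩
    · rintro ⟨_, rfl, g, hg, rfl⟩
      rw [iConvexComb_single]
      exact hg none

namespace Cdown

lemma map_id_fun (U : Cdown A) : U.map (fun a => a) = U := by
  refine Cdown.ext ?_
  change (fun φ : Distr (Option A) => φ.map (Option.map id)) '' U.toSet = U.toSet
  simp

lemma map_map (f : A → B) (g : B → C) (U : Cdown A) :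
    (U.map f).map g = U.map fun a => g (f a) := by
  refine Cdown.ext ?_
  change (fun φ => φ.map (Option.map g)) '' ((fun φ => φ.map (Option.map f)) '' U.toSet) =
    (fun φ => φ.map (Option.map fun a => g (f a))) '' U.toSet
  rw [Set.image_image]
  simp [StdSimplex.map_map, Option.map_map, Function.comp_def]

lemma map_pure (f : A → B) (x : A) : (pure x).map f = pure (f x) := by
  refine Cdown.ext (Set.Subset.antisymm ?_ ?_)
  · rintro _ ⟨_, ⟨p, h0, h1, rfl⟩, rfl⟩
    exact ⟨p, h0, h1, by simp⟩
  · rintro _ ⟨p, h0, h1, rfl⟩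
    exact ⟨_, ⟨p, h0, h1, rfl⟩, by simp⟩

lemma map_join (f : A → B) (S : Cdown (Cdown A)) :
    S.join.map f = (S.map (map f)).join := by
  refine Cdown.ext (Set.Subset.antisymm ?_ fun θ hθ => ?_)
  · rintro _ ⟨θ, hθ, rfl⟩
    obtain ⟨Φ, hΦ, g, hg, rfl⟩ := mem_cdownMul.1 hθ
    dsimp only
    rw [map_iConvexComb]
    exact iConvexComb_mem_cdownMul (h := Option.map (map f)) ⟨Φ, hΦ, rfl⟩ fun o =>
      cdownStar_map f o ▸ ⟨_, hg o, rfl⟩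
  · obtain ⟨_, ⟨Φ, hΦ, rfl⟩, g, hg, rfl⟩ := mem_cdownMul.1 hθ
    -- Lifts the selection through the images under `f`.
    choose k hk hkg using fun o : Option (Cdown A) =>
      (cdownStar_map f o ▸ hg (o.map (map f)) : _ ∈ cdownMap f (cdownStar o))
    refine ⟨Φ.iConvexComb k, mem_cdownMul.2 ⟨Φ, hΦ, k, hk, rfl⟩, ?_⟩
    dsimp only
    rw [map_iConvexComb, iConvexComb_map]
    exact congrArg _ (funext hkg)

lemma join_map_join (S : Cdown (Cdown (Cdown A))) : (S.map join).join = S.join.join := by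
  refine Cdown.ext (Set.Subset.antisymm (fun θ hθ => ?_) fun θ hθ => ?_)
  · obtain ⟨_, ⟨Φ, hΦ, rfl⟩, g, hg, rfl⟩ := mem_cdownMul.1 hθ
    choose Ψ hΨ k hk hkg using fun o : Option (Cdown (Cdown A)) =>
      mem_cdownStar_join.1 (hg (o.map join))
    dsimp only
    rw [iConvexComb_map, funext hkg]
    -- The inner selection `k o` varies with the outer index; convexity absorbs this dependence.
    exact iConvexComb_mem_cdownMul' (mem_cdownMul.2 ⟨Φ, hΦ, Ψ, hΨ, rfl⟩) hk
  · obtain ⟨_, hΨ, g, hg, rfl⟩ := mem_cdownMul.1 hθ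
    obtain ⟨Φ, hΦ, k, hk, rfl⟩ := mem_cdownMul.1 hΨ
    rw [← iConvexComb_assoc]
    exact iConvexComb_mem_cdownMul (h := Option.map join) ⟨Φ, hΦ, rfl⟩ fun o =>
      mem_cdownStar_join.2 ⟨k o, hk o, g, hg, rfl⟩

/-- The combinations are `p φ + (1 - p) δ_⋆` with `φ ∈ U`; they stay in `U` because `δ_⋆ ∈ U` and
`U` is convex. -/
lemma join_pure (U : Cdown A) : (pure U).join = U := by
  refine Cdown.ext (Set.Subset.antisymm (fun θ hθ => ?_) fun φ hφ => ?_)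
  · obtain ⟨_, ⟨p, h0, h1, rfl⟩, g, hg, rfl⟩ := mem_cdownMul.1 hθ
    have e : (StdSimplex.duple (some U) none h0 (sub_nonneg.2 h1) (add_sub_cancel p 1)).iConvexComb
        g = convexCombPair p (1 - p) h0 (sub_nonneg.2 h1) (add_sub_cancel p 1) (g (some U))
          (g none) := by
      simp [StdSimplex.iConvexComb, convexCombPair]
    rw [e]
    refine U.2.1.convex.convexCombPair_mem (hg (some U)) ?_ _ _ _
    rw [show g none = _ from hg none]
    exact single_none_mem U
  · have := iConvexComb_mem_cdownMul (S := cdownUnit U) (w := StdSimplex.single ())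
      (h := fun _ => some U) (g := fun _ => φ)
      ⟨1, zero_le_one, le_rfl, ext_some fun a => by simp⟩ fun _ => hφ
    rwa [iConvexComb_single] at this

/-- Choosing from `η a` means choosing a probability of keeping `a`, so the combination is a
thinning of `φ`, and `U` is `⊥`-closed. -/
lemma join_map_pure (U : Cdown A) : (U.map pure).join = U := by
  refine Cdown.ext (Set.Subset.antisymm (fun θ hθ => ?_) fun φ hφ => ?_)
  · obtain ⟨_, ⟨φ, hφ, rfl⟩, g, hg, rfl⟩ := mem_cdownMul.1 hθ
    choose p h0 h1 hp using fun a : A => hg (some (pure a))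
    dsimp only
    rw [iConvexComb_map]
    have e : (fun o : Option A => g (o.map pure)) = keep fun a => ⟨p a, h0 a, h1 a⟩ := by
      funext o
      cases o with
      | none => exact hg none
      | some a => exact hp a
    rw [e]
    exact isBotClosed_iff.1 U.2.2 φ hφ _
  · have := iConvexComb_mem_cdownMul (S := cdownMap pure U.toSet) (w := φ)
      (h := Option.map pure) (g := StdSimplex.single) ⟨φ, hφ, rfl⟩ fun o => ?_
    · rwa [StdSimplex.iConvexComb_dirac] at this
    · cases o with
      | none => rfl
      | some a => exact ⟨1, zero_le_one, le_rfl, ext_some fun b => by simp⟩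

end Cdown

end Laws

/-! ### Non-expansiveness -/

section Nonexpansive

variable {X Y : OneMet.{u}}

lemma hausKant_map_le (f : X ⟶ Y) (S T : Cdown X.carrier) :
    hausKant Y (S.map f.toFun) (T.map f.toFun) ≤ hausKant X S T := by
  have hX := isOneBoundedMetric_optionDist X.isOneBoundedMetric
  have hY := isOneBoundedMetric_optionDist Y.isOneBoundedMetric
  have key := kantorovich_map_le hY.nonneg (d := optionDist fun x y : X.carrier => dist x y)
    (Option.map f.toFun) (by
      intro a b
      cases a <;> cases b <;> simp [optionDist, f.nonexpansive])
  have h : ∀ S T : Cdown X.carrier, ∀ φ ∈ (S.map f.toFun).toSet, ∀ ε > 0,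
      ∃ ψ ∈ (T.map f.toFun).toSet,
        kantorovich (optionDist fun x y : Y.carrier => dist x y) φ ψ ≤ hausKant X S T + ε := by
    rintro S T _ ⟨φ, hφ, rfl⟩ ε hε
    obtain ⟨ψ, hψ, hlt⟩ := exists_lt_hausdorff_add (kantorovich_nonneg hX.nonneg)
      (kantorovich_le_one hX.nonneg hX.le_one) T.2.1.nonempty hφ hε
    exact ⟨_, ⟨ψ, hψ, rfl⟩, (key φ ψ).trans hlt.le⟩
  refine hausdorff_le (kantorovich_nonneg hY.nonneg) (S.map f.toFun).2.1.nonempty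
    (T.map f.toFun).2.1.nonempty (h S T) fun ψ hψ ε hε => ?_
  obtain ⟨φ, hφ, hle⟩ := h T S ψ hψ ε hε
  rw [(hausKant_isOneBoundedMetric X).symm T S] at hle
  exact ⟨φ, hφ, (kantorovich_comm_le hY.nonneg hY.symm _ _).trans hle⟩

lemma hausKant_pure_le (x y : X.carrier) :
    hausKant X (Cdown.pure x) (Cdown.pure y) ≤ dist x y := by
  have hX := isOneBoundedMetric_optionDist X.isOneBoundedMetric
  have h : ∀ x y : X.carrier, ∀ φ ∈ cdownUnit x, ∀ ε > 0, ∃ ψ ∈ cdownUnit y,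
      kantorovich (optionDist fun x y : X.carrier => dist x y) φ ψ ≤ dist x y + ε := by
    rintro x y _ ⟨p, h0, h1, rfl⟩ ε hε
    refine ⟨_, ⟨p, h0, h1, rfl⟩, ?_⟩
    -- Same `p` on both sides: move `x` to `y` and leave `⋆` in place.
    have hc : StdSimplex.duple (some x, some y) (none, none) h0 (sub_nonneg.2 h1)
        (add_sub_cancel p 1) ∈ Coup
          (StdSimplex.duple (some x) none h0 (sub_nonneg.2 h1) (add_sub_cancel p 1))
          (StdSimplex.duple (some y) none h0 (sub_nonneg.2 h1) (add_sub_cancel p 1)) := by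
      constructor <;> simp
    refine (kantorovich_le hX.nonneg hc).trans ?_
    refine (StdSimplex.iConvexComb_mono (g := fun _ => dist x y) fun q hq => ?_).trans ?_
    · have : q = (some x, some y) ∨ q = (none, none) := by
        by_contra! hne
        exact hq (by simp [hne.1.symm, hne.2.symm])
      rcases this with rfl | rfl <;> simp [optionDist]
    · rw [iConvexComb_const]
      linarith
  refine hausdorff_le (kantorovich_nonneg hX.nonneg) (Cdown.pure x).2.1.nonempty
    (Cdown.pure y).2.1.nonempty (h x y) fun ψ hψ ε hε => ?_
  obtain ⟨φ, hφ, hle⟩ := h y x ψ hψ ε hε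
  rw [dist_comm] at hle
  exact ⟨φ, hφ, (kantorovich_comm_le hX.nonneg hX.symm _ _).trans hle⟩

/-- If exactly one of `o`, `o'` is `⋆`, the allowance is at least `1`, which bounds every
Kantorovich distance. -/
lemma exists_mem_cdownStar_kantorovich_le {g : Option (Cdown X.carrier) → Distr (Option X.carrier)}
    (hg : ∀ o, g o ∈ cdownStar o) {ε : ℝ} (hε : 0 < ε) (o o' : Option (Cdown X.carrier)) :
    ∃ φ ∈ cdownStar o', kantorovich (optionDist fun x y : X.carrier => dist x y) (g o) φ ≤
      optionDist (hausKant X) o o' + ε := by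
  have hX := isOneBoundedMetric_optionDist X.isOneBoundedMetric
  have h0 := kantorovich_nonneg hX.nonneg
  have h1 := kantorovich_le_one hX.nonneg hX.le_one
  cases o with
  | none =>
    cases o' with
    | none =>
      refine ⟨g none, hg none, ?_⟩
      rw [kantorovich_self hX.nonneg fun a => (hX.eq_zero_iff a a).2 rfl]
      simpa [optionDist] using hε.le
    | some V =>
      exact ⟨g (some V), hg _, (h1 _ _).trans (by simpa [optionDist] using hε.le)⟩
  | some U =>
    cases o' with
    | none => exact ⟨g none, hg _, (h1 _ _).trans (by simpa [optionDist] using hε.le)⟩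
    | some V =>
      obtain ⟨φ, hφ, hlt⟩ := exists_lt_hausdorff_add h0 h1 V.2.1.nonempty (hg (some U)) hε
      exact ⟨φ, hφ, hlt.le⟩

lemma hausKant_join_le (S T : Cdown (Cdown X.carrier)) :
    hausKant X S.join T.join ≤ hausKant (hkObj hausKant_isOneBoundedMetric X) S T := by
  have hX := isOneBoundedMetric_optionDist X.isOneBoundedMetric
  have hF := isOneBoundedMetric_optionDist (hausKant_isOneBoundedMetric X)
  have h : ∀ S T : Cdown (Cdown X.carrier), ∀ θ ∈ S.join.toSet, ∀ ε > 0, ∃ χ ∈ T.join.toSet,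
      kantorovich (optionDist fun x y : X.carrier => dist x y) θ χ ≤
        hausKant (hkObj hausKant_isOneBoundedMetric X) S T + ε := by
    intro S T θ hθ ε hε
    obtain ⟨Φ, hΦ, g, hg, rfl⟩ := mem_cdownMul.1 hθ
    obtain ⟨Ψ, hΨ, hlt⟩ := exists_lt_hausdorff_add (kantorovich_nonneg hF.nonneg)
      (kantorovich_le_one hF.nonneg hF.le_one) T.2.1.nonempty hΦ (half_pos hε)
    obtain ⟨ω, ⟨rfl, rfl⟩, hω⟩ := exists_coup_lt hlt
    -- The partner `k p` depends on both sets of the pair, not only on the target set.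
    choose k hk hkle using fun p : Option (Cdown X.carrier) × Option (Cdown X.carrier) =>
      exists_mem_cdownStar_kantorovich_le hg (half_pos hε) p.1 p.2
    refine ⟨ω.iConvexComb k, iConvexComb_mem_cdownMul hΨ hk, ?_⟩
    rw [iConvexComb_map]
    refine (kantorovich_iConvexComb_le hX.nonneg ω _ k).trans ?_
    refine (StdSimplex.iConvexComb_mono fun p _ => hkle p).trans ?_
    rw [StdSimplex.iConvexComb_add, iConvexComb_const]
    -- The metric of `hkObj` is `hausKant X` by definition.
    have e : (ω.iConvexComb fun p => optionDist (hausKant X) p.1 p.2) <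
        hausKant (hkObj hausKant_isOneBoundedMetric X) S T + ε / 2 := hω
    linarith
  refine hausdorff_le (kantorovich_nonneg hX.nonneg) S.join.2.1.nonempty
    T.join.2.1.nonempty (h S T) fun ψ hψ ε hε => ?_
  obtain ⟨φ, hφ, hle⟩ := h T S ψ hψ ε hε
  rw [(hausKant_isOneBoundedMetric (hkObj hausKant_isOneBoundedMetric X)).symm T S] at hle
  exact ⟨φ, hφ, (kantorovich_comm_le hX.nonneg hX.symm _ _).trans hle⟩

end Nonexpansive


/-! ### Assembly of the monad. -/

theorem mainTheorem6 :
    -- the Hausdorff–Kantorovich distance is a 1-bounded metric on every `C↓(X)`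
    ∃ (hHK : ∀ X : OneMet.{u}, IsOneBoundedMetric (hausKant X))
      -- the functor `X ↦ (C↓(X), HK(d))`
      (map : ∀ {X Y : OneMet.{u}}, (X ⟶ Y) → (hkObj hHK X ⟶ hkObj hHK Y))
      (map_id : ∀ X : OneMet.{u}, map (𝟙 X) = 𝟙 (hkObj hHK X))
      (map_comp : ∀ {X Y Z : OneMet.{u}} (f : X ⟶ Y) (g : Y ⟶ Z),
        map (f ≫ g) = map f ≫ map g),
      let F : OneMet.{u} ⥤ OneMet.{u} :=
        { obj := hkObj hHK, map := map, map_id := map_id, map_comp := map_comp }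
      -- a monad with this functor
      ∃ (η : 𝟭 OneMet.{u} ⟶ F) (μ : F ⋙ F ⟶ F)
        (assoc : ∀ X, F.map (μ.app X) ≫ μ.app X = μ.app (F.obj X) ≫ μ.app X)
        (left_unit : ∀ X, η.app (F.obj X) ≫ μ.app X = 𝟙 (F.obj X))
        (right_unit : ∀ X, F.map (η.app X) ≫ μ.app X = 𝟙 (F.obj X)),
        let M : CategoryTheory.Monad OneMet.{u} :=
          { toFunctor := F, η := η, μ := μ, assoc := assoc,
            left_unit := left_unit, right_unit := right_unit }
        -- whose underlying maps are those of the set monad `C↓`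
        (∀ (X Y : OneMet.{u}) (f : X ⟶ Y) (S : Cdown X.carrier),
          Cdown.toSet (A := Y.carrier) ((M.map f).toFun S) =
            cdownMap f.toFun S.toSet) ∧
        (∀ (X : OneMet.{u}) (x : X.carrier),
          Cdown.toSet (A := X.carrier) ((M.η.app X).toFun x) =
            cdownUnit x) ∧
        (∀ (X : OneMet.{u}) (S : Cdown (Cdown X.carrier)),
          Cdown.toSet (A := X.carrier) ((M.μ.app X).toFun S) =
            cdownMul S.toSet) := by
  exact ⟨hausKant_isOneBoundedMetric,
    fun f => ⟨Cdown.map f.toFun, hausKant_map_le f⟩,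
    fun X => OneMet.Hom.ext (funext Cdown.map_id_fun),
    fun f g => OneMet.Hom.ext (funext fun U => (Cdown.map_map f.toFun g.toFun U).symm),
    { app := fun X => ⟨Cdown.pure, hausKant_pure_le⟩
      naturality := fun X Y f => OneMet.Hom.ext
        (funext fun x => (Cdown.map_pure f.toFun x).symm) },
    { app := fun X => ⟨Cdown.join, hausKant_join_le⟩
      naturality := fun X Y f => OneMet.Hom.ext
        (funext fun S => (Cdown.map_join f.toFun S).symm) },
    fun X => OneMet.Hom.ext (funext Cdown.join_map_join),
    fun X => OneMet.Hom.ext (funext Cdown.join_pure),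
    fun X => OneMet.Hom.ext (funext Cdown.join_map_pure),
    fun _ _ _ _ => rfl, fun _ _ => rfl, fun _ _ => rfl⟩
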